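/- Let $G$ be a $\sigma$-compact locally compact (Hausdorff) abelian group, $H$ a locally compact (Hausdorff) abelian group, and $(G\times H,\widetilde L)$ a cut and project scheme: $\widetilde L\subset G\times H$ is a lattice (a discrete subgroup with compact quotient), the projection $\pi_1:G\times H\to G$ is one-to-one on $\widetilde L$, and $\pi_2(\widetilde L)$ is dense in $H$. For $x\in\pi_1(\widetilde L)$ let $x^*\in H$ be the unique element with $(x,x^*)\in\widetilde L$, and for $V\subset H$ put $\Lambda(V)=\{x\in\pi_1(\widetilde L): x^*\in V\}$. A measure on $G$ is a complex Radon measure, that is, a linear functional $\mu$ on $C_c(G)$ such that for each compact $K\subset G$ there is a constant $C_K$ with $|\mu(f)|\le C_K\|f\|_\infty$ for all $f\in C_c(G)$ supported in $K$. Write $(\mu*f)(x)=\int_G f(x-y)\,d\mu(y)$. The measure $\mu$ is translation bounded if $\mu*f$ is bounded and uniformly continuous for every $f\in C_c(G)$; it is strongly almost periodic if it is translation bounded and, for every $f\in C_c(G)$, the function $\mu*f$ is Bohr almost periodic, i.e. its set of translates is precompact in the sup norm. Write $\mu\le\nu$ if $\nu-\mu$ is a positive measure. Let $W\subset H$ be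 precompact (i.e. $\overline W$ is compact) and let $U\subset H$ be an open set with $\overline W\subset U$. Then $\Lambda(U)$ is a strong dominating set for $\Lambda(W)$. That is, $\Lambda(W)$ is closed in $G$, $\Lambda(W)\subset\Lambda(U)$, and for every real valued translation bounded measure $\mu$ on $G$ with $\operatorname{supp}(\mu)\subset\Lambda(W)$ there is a strongly almost periodic measure $\nu$ on $G$ with $\operatorname{supp}(\nu)\subset\Lambda(U)$ and $\mu\le\nu$. -/

import Mathlib

open scoped CompactlySupported BoundedContinuousFunction Topology

namespace CutProject

noncomputable section

/-! ### Cut and project schemes -/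

/-- A cut and project scheme over `G × H`: a lattice (discrete cocompact subgroup) of `G × H` on
which the first projection is one-to-one and whose second projection is dense in `H`. -/
structure Scheme (G H : Type*) [AddCommGroup G] [TopologicalSpace G]
    [AddCommGroup H] [TopologicalSpace H] where
  lattice : AddSubgroup (G × H)
  discrete : DiscreteTopology lattice
  cocompact : CompactSpace ((G × H) ⧸ lattice)
  injOn_fst : Set.InjOn Prod.fst (lattice : Set (G × H))
  dense_snd : Dense (Prod.snd '' (lattice : Set (G × H)))

namespace Scheme

variable {G H : Type*} [AddCommGroup G] [TopologicalSpace G] [AddCommGroup H] [TopologicalSpace H]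

/-- The projection of the lattice to `G`. -/
def projG (S : Scheme G H) : Set G := Prod.fst '' (S.lattice : Set (G × H))

/-- The star map `x ↦ x*`: the second coordinate of the unique lattice point above `x`. -/
def star (S : Scheme G H) (x : S.projG) : H := (Classical.choose x.2).2

/-- `Λ(W)`, the set of all `x` in the projected lattice with `x* ∈ W`. -/
def modelSet (S : Scheme G H) (W : Set H) : Set G :=
  {x | ∃ hx : x ∈ S.projG, S.star ⟨x, hx⟩ ∈ W}

theorem star_mem (S : Scheme G H) (x : S.projG) : ((x : G), S.star x) ∈ S.lattice := by
  have h := Classical.choose_spec x.2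
  have e : ((x : G), S.star x) = Classical.choose x.2 := Prod.ext h.2.symm rfl
  rw [e]
  exact h.1

theorem mem_modelSet_iff (S : Scheme G H) (W : Set H) (x : G) :
    x ∈ S.modelSet W ↔ ∃ y ∈ W, (x, y) ∈ S.lattice := by
  constructor
  · rintro ⟨hx, hW⟩
    exact ⟨_, hW, S.star_mem ⟨x, hx⟩⟩
  · rintro ⟨y, hy, hL⟩
    have hx : x ∈ S.projG := ⟨(x, y), hL, rfl⟩
    have e : S.star ⟨x, hx⟩ = y :=
      congrArg Prod.snd (S.injOn_fst (S.star_mem ⟨x, hx⟩) hL rfl)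
    exact ⟨hx, by rw [e]; exact hy⟩

end Scheme

/-! ### Measures on a locally compact group, as functionals on `C_c(G)` -/

/-- A complex Radon measure on `G`: a linear functional `μ` on `C_c(G)` such that for every compact
`K` there is a constant `C` with `|μ(f)| ≤ C ‖f‖_∞` for all `f` supported in `K`. -/
structure RadonMeasure (G : Type*) [TopologicalSpace G] where
  toLinearMap : C_c(G, ℂ) →ₗ[ℂ] ℂ
  bound : ∀ K : Set G, IsCompact K → ∃ C : ℝ, ∀ f : C_c(G, ℂ), tsupport f ⊆ K →
    ∀ M : ℝ, (∀ x, ‖f x‖ ≤ M) → ‖toLinearMap f‖ ≤ C * M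

namespace RadonMeasure

section General

variable {G : Type*} [TopologicalSpace G]

instance : CoeFun (RadonMeasure G) (fun _ => C_c(G, ℂ) → ℂ) := ⟨fun μ f => μ.toLinearMap f⟩

/-- `μ` takes real values on real-valued test functions. -/
def IsReal (μ : RadonMeasure G) : Prop :=
  ∀ f : C_c(G, ℂ), (∀ x, (f x).im = 0) → (μ f).im = 0

/-- `μ ≤ ν`: the measure `ν - μ` is positive, that is, `(ν - μ)(f)` is a nonnegative real number
for every test function `f` with nonnegative real values. -/
def IsDominatedBy (μ ν : RadonMeasure G) : Prop :=
  ∀ f : C_c(G, ℂ), (∀ x, (f x).im = 0 ∧ 0 ≤ (f x).re) →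
    (ν f - μ f).im = 0 ∧ 0 ≤ (ν f - μ f).re

/-- The support of `μ`: the complement of the largest open set on which `μ` vanishes. -/
def supp (μ : RadonMeasure G) : Set G :=
  {x | ∀ V ∈ 𝓝 x, ∃ f : C_c(G, ℂ), tsupport f ⊆ V ∧ μ f ≠ 0}

end General

variable {G : Type*} [AddCommGroup G] [TopologicalSpace G] [IsTopologicalAddGroup G]

/-- The test function `y ↦ f (x - y)`. -/
def reflect (f : C_c(G, ℂ)) (x : G) : C_c(G, ℂ) where
  toFun y := f (x - y)
  continuous_toFun := f.continuous.comp (by fun_prop)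
  hasCompactSupport' := f.hasCompactSupport.comp_homeomorph (Homeomorph.subLeft x)

/-- The convolution `(μ * f)(x) = ∫ f (x - y) dμ(y)`. -/
def conv (μ : RadonMeasure G) (f : C_c(G, ℂ)) (x : G) : ℂ := μ (reflect f x)

end RadonMeasure

variable {G : Type*} [AddCommGroup G] [TopologicalSpace G] [IsTopologicalAddGroup G]

/-- Uniform continuity with respect to the group uniformity of `G`. -/
def IsUniformlyContinuous (f : G → ℂ) : Prop :=
  @UniformContinuous G ℂ (IsTopologicalAddGroup.rightUniformSpace G) _ f

/-- The translate `(T^x f)(y) = f (-x + y)`. -/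
def translate (x : G) (f : G →ᵇ ℂ) : G →ᵇ ℂ :=
  f.compContinuous ⟨fun y => -x + y, by fun_prop⟩

/-- Bohr almost periodicity: `f` is bounded and uniformly continuous, and its translates form a
precompact set in the sup norm. (The uniformly continuous functions are closed in `G →ᵇ ℂ`, so the
closure may be taken here.) -/
def IsBohrAlmostPeriodic (f : G → ℂ) : Prop :=
  IsUniformlyContinuous f ∧
    ∃ F : G →ᵇ ℂ, ⇑F = f ∧ IsCompact (closure (Set.range fun x : G => translate x F))

namespace RadonMeasure

/-- `μ * f` is bounded and uniformly continuous for every `f` in `C_c(G)`. -/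
def IsTranslationBounded (μ : RadonMeasure G) : Prop :=
  ∀ f : C_c(G, ℂ), IsUniformlyContinuous (μ.conv f) ∧ ∃ C : ℝ, ∀ x, ‖μ.conv f x‖ ≤ C

/-- `μ` is translation bounded and `μ * f` is Bohr almost periodic for every `f` in `C_c(G)`. -/
def IsStronglyAlmostPeriodic (μ : RadonMeasure G) : Prop :=
  μ.IsTranslationBounded ∧ ∀ f : C_c(G, ℂ), IsBohrAlmostPeriodic (μ.conv f)

end RadonMeasure

/-- `B` is a strong dominating set for the closed set `A`. -/
def IsStrongDominatingSet (A B : Set G) : Prop :=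
  IsClosed A ∧ A ⊆ B ∧
    ∀ μ : RadonMeasure G, μ.IsReal → μ.IsTranslationBounded → μ.supp ⊆ A →
      ∃ ν : RadonMeasure G, ν.IsStronglyAlmostPeriodic ∧ ν.supp ⊆ B ∧ μ.IsDominatedBy ν

end

end CutProject

/-! Choose a bump `φ` on `H` equal to 1 on `closure W` and supported in `U`, and let `ν` be the comb
`∑ D φ(x*) δ_x`. Each `ν * f` is the restriction to `G` of a continuous function on the compact
group `(G × H) ⧸ L`, a lattice periodization (`conv_comb_eq`), hence Bohr almost periodic.
Differences of points of `Λ(W)` lie in the locally finite set `Λ(W - W)`, so `Λ(W)` is uniformly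
discrete (`exists_nhds_zero_separating_modelSet`). If `β` is a bump at 0 that separates its points,
then `μ` is a sum of point masses `(μ * β)(x)`, `x ∈ Λ(W)` (via `apply_eq_zero_of_eqOn_supp`).
Translation boundedness bounds them by a single `D`, the weight of `ν` there. -/

open scoped Pointwise

namespace CutProject

noncomputable section

/-! ### Periodization over a discrete subgroup -/

section Periodization

variable {X : Type*} [AddCommGroup X] [TopologicalSpace X] [IsTopologicalAddGroup X] [T2Space X]

theorem finite_setOf_coe_mem_of_isCompact (L : AddSubgroup X) [DiscreteTopology L] {K : Set X}
    (hK : IsCompact K) : {l : L | (l : X) ∈ K}.Finite := by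
  have h := L.tendsto_coe_cofinite_of_discrete (SetLike.isDiscrete_iff_discreteTopology.2 ‹_›)
    hK.compl_mem_cocompact
  rwa [Filter.mem_map, Filter.mem_cofinite, Set.preimage_compl, compl_compl] at h

theorem continuous_finsum_sub [LocallyCompactSpace X] (L : AddSubgroup X) [DiscreteTopology L]
    (h : C_c(X, ℂ)) : Continuous fun p => ∑ᶠ l : L, h (p - l) := by
  refine continuous_finsum (fun l => by fun_prop) fun p => ?_
  obtain ⟨N, hN, hp⟩ := exists_compact_mem_nhds p
  refine ⟨N, hp, (finite_setOf_coe_mem_of_isCompact L (hN.add h.hasCompactSupport.isCompact.neg)).subset ?_⟩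
  rintro l ⟨x, hx, hxN⟩
  exact ⟨x, hxN, l - x, by simpa using subset_tsupport h hx, by simp⟩

/-- The periodization of `h` with respect to a discrete subgroup `L`, on the quotient by `L`. -/
def periodization [LocallyCompactSpace X] (L : AddSubgroup X) [DiscreteTopology L]
    (h : C_c(X, ℂ)) : C(X ⧸ L, ℂ) where
  toFun := Quotient.lift (fun p => ∑ᶠ l : L, h (p - l)) (by
    intro a b hab
    have hab' : -a + b ∈ L := QuotientAddGroup.leftRel_apply.1 hab
    refine (finsum_comp_equiv (Equiv.addRight (⟨-a + b, hab'⟩ : L))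
      (f := fun l : L => h (b - l))).symm.trans ?_ |>.symm
    refine finsum_congr fun l => ?_
    congr 1
    simp only [Equiv.coe_addRight, AddSubgroup.coe_add]
    abel)
  continuous_toFun := (continuous_finsum_sub L h).quotient_lift _

theorem periodization_mk [LocallyCompactSpace X] (L : AddSubgroup X) [DiscreteTopology L]
    (h : C_c(X, ℂ)) (p : X) :
    periodization L h (QuotientAddGroup.mk p) = ∑ᶠ l : L, h (p - l) := rfl

end Periodization

/-! ### Almost periodicity from compact groups -/

section AlmostPeriodic

variable {G T : Type*} [AddCommGroup G] [TopologicalSpace G] [IsTopologicalAddGroup G]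
  [AddCommGroup T] [TopologicalSpace T] [IsTopologicalAddGroup T] [CompactSpace T]

theorem isUniformlyContinuous_comp_addMonoidHom (F : C(T, ℂ)) (i : G →+ T) (hi : Continuous i) :
    IsUniformlyContinuous (F ∘ i) := by
  let := IsTopologicalAddGroup.rightUniformSpace G
  let := IsTopologicalAddGroup.rightUniformSpace T
  have : IsUniformAddGroup G := isUniformAddGroup_of_addCommGroup
  have : IsUniformAddGroup T := isUniformAddGroup_of_addCommGroup
  exact (CompactSpace.uniformContinuous_of_continuous F.continuous).comp
    (uniformContinuous_addMonoidHom_of_continuous hi)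

/-- A continuous function on a compact group, restricted along a continuous homomorphism,
is Bohr almost periodic. -/
theorem isBohrAlmostPeriodic_comp_addMonoidHom (F : C(T, ℂ)) (i : G →+ T) (hi : Continuous i) :
    IsBohrAlmostPeriodic (F ∘ i) := by
  refine ⟨isUniformlyContinuous_comp_addMonoidHom F i hi,
    (BoundedContinuousFunction.mkOfCompact F).compContinuous ⟨i, hi⟩, rfl, ?_⟩
  -- `Φ t` is `y ↦ F (t + i y)`. Currying makes it sup-norm continuous in `t`, so its compact range
  -- contains every translate.
  let Φ : T → (G →ᵇ ℂ) := fun t =>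
    (BoundedContinuousFunction.mkOfCompact
      (ContinuousMap.curry ⟨fun q : T × T => F (q.1 + q.2), by fun_prop⟩ t)).compContinuous ⟨i, hi⟩
  have hΦ : Continuous Φ :=
    (BoundedContinuousFunction.continuous_compContinuous _).comp
      ((ContinuousMap.isometryEquivBoundedOfCompact T ℂ).continuous.comp
        (ContinuousMap.continuous _))
  refine (isCompact_range hΦ).closure_of_subset ?_
  rintro _ ⟨x, rfl⟩
  refine ⟨i (-x), ?_⟩
  ext y
  simp [Φ, translate]

end AlmostPeriodic

namespace RadonMeasure

/-! ### Measures and their supports -/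

section Support

variable {G : Type*} [TopologicalSpace G] [T2Space G] [LocallyCompactSpace G]

/-- A partition of unity splits `f` into pieces, each supported where `μ` vanishes locally. -/
theorem apply_eq_zero_of_disjoint_tsupport (μ : RadonMeasure G) (f : C_c(G, ℂ))
    (h : Disjoint (tsupport f) μ.supp) : μ f = 0 := by
  have hV : ∀ x ∈ tsupport f, ∃ V ∈ 𝓝 x, ∀ g : C_c(G, ℂ), tsupport g ⊆ V → μ g = 0 := by
    intro x hx
    have := Set.disjoint_left.1 h hx
    simp only [supp, Set.mem_ofPred_eq] at this
    push Not at this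
    exact this
  choose! V hVn hV0 using hV
  obtain ⟨t, ht, hcov⟩ := f.hasCompactSupport.isCompact.elim_nhds_subcover
    (fun x => interior (V x)) (fun x hx => interior_mem_nhds.2 (hVn x hx))
  let e := t.equivFin
  obtain ⟨p, hpV, hp1, -, -⟩ := exists_continuous_sum_one_of_isOpen_isCompact
    (s := fun i => interior (V (e.symm i))) (fun _ => isOpen_interior) f.hasCompactSupport (by
      intro x hx
      obtain ⟨y, hy, hxy⟩ := Set.mem_iUnion₂.1 (hcov hx)
      exact Set.mem_iUnion.2 ⟨e ⟨y, hy⟩, by simpa using hxy⟩)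
  let q : Fin _ → C_c(G, ℂ) := fun i =>
    ⟨⟨fun x => (p i x : ℂ) * f x, by fun_prop⟩, f.hasCompactSupport.mul_left⟩
  have hq : f = ∑ i, q i := by
    ext x
    rw [CompactlySupportedContinuousMap.sum_apply]
    change f x = ∑ i, (p i x : ℂ) * f x
    rw [← Finset.sum_mul]
    by_cases hx : x ∈ tsupport f
    · have := hp1 hx
      simp only [Finset.sum_apply, Pi.one_apply] at this
      rw [← Complex.ofReal_sum, this]
      simp
    · simp [image_eq_zero_of_notMem_tsupport hx]
  rw [hq]
  refine (map_sum μ.toLinearMap _ _).trans (Finset.sum_eq_zero fun i _ => hV0 _ (ht _ (e.symm i).2) _ ?_)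
  refine (closure_mono ?_).trans ((hpV i).trans interior_subset)
  intro x hx h0
  exact hx (by simp [q, h0])

/-- Here `tsupport f` may meet the support of `μ`. Truncating `f` at height `ε` changes it only away
from that support and leaves a function of norm at most `ε`; then `ε → 0`. -/
theorem apply_eq_zero_of_eqOn_supp (μ : RadonMeasure G) (f : C_c(G, ℂ))
    (h : ∀ x ∈ μ.supp, f x = 0) : μ f = 0 := by
  obtain ⟨C, hC⟩ := μ.bound _ f.hasCompactSupport
  have key : ∀ ε > 0, ‖μ f‖ ≤ C * ε := by
    intro ε hε
    have hm : ∀ z : ℂ, 0 < max ‖z‖ ε := fun z => lt_max_of_lt_right hε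
    -- Radial retraction onto the disc of radius `ε`.
    let θ : C(ℂ, ℂ) := ⟨fun z => (ε / max ‖z‖ ε : ℝ) * z, by
      have : ∀ z : ℂ, max ‖z‖ ε ≠ 0 := fun z => (hm z).ne'
      fun_prop (disch := exact this)⟩
    have hθ (z : ℂ) : θ z = (ε / max ‖z‖ ε : ℝ) * z := rfl
    have hθ0 : θ 0 = 0 := by simp [hθ]
    let g := f.compLeft θ
    have hg (x : G) : g x = θ (f x) := CompactlySupportedContinuousMap.compLeft_apply hθ0 f x
    have hfg : μ (f - g) = 0 := by
      refine apply_eq_zero_of_disjoint_tsupport μ _ (Set.disjoint_left.2 fun x hx hxs => ?_)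
      have hcl : tsupport (f - g) ⊆ {x | ε ≤ ‖f x‖} := by
        refine closure_minimal (fun y hy => ?_) (isClosed_le (by fun_prop) (by fun_prop))
        by_contra hlt
        refine hy ?_
        have hlt' : ‖f y‖ ≤ ε := (not_le.1 hlt).le
        rw [CompactlySupportedContinuousMap.sub_apply, hg, hθ, max_eq_right hlt',
          div_self hε.ne', Complex.ofReal_one, one_mul, sub_self]
      have := hcl hx
      simp only [Set.mem_ofPred_eq, h x hxs, norm_zero] at this
      linarith
    have hfg' : μ f = μ g := sub_eq_zero.1 ((map_sub μ.toLinearMap _ _).symm.trans hfg)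
    rw [hfg']
    refine hC g (closure_mono fun x hx h0 => hx ?_) ε fun x => ?_
    · rw [hg, h0, hθ0]
    · rw [hg, hθ, norm_mul, Complex.norm_real, Real.norm_of_nonneg (div_pos hε (hm _)).le,
        div_mul_eq_mul_div, div_le_iff₀ (hm _)]
      gcongr
      exact le_max_left _ _
  have hlim : Filter.Tendsto (fun ε : ℝ => C * ε) (𝓝[>] 0) (𝓝 0) := by
    have : Filter.Tendsto (fun ε : ℝ => C * ε) (𝓝 0) (𝓝 (C * 0)) :=
      (continuous_const.mul continuous_id).tendsto 0
    rw [mul_zero] at this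
    exact this.mono_left nhdsWithin_le_nhds
  exact norm_le_zero_iff.1
    (ge_of_tendsto hlim (Filter.eventually_of_mem self_mem_nhdsWithin key))

end Support

end RadonMeasure

/-! ### Model sets and weighted combs -/

namespace Scheme

variable {G H : Type*} [AddCommGroup G] [TopologicalSpace G] [AddCommGroup H] [TopologicalSpace H]

theorem modelSet_mono (S : Scheme G H) {V V' : Set H} (h : V ⊆ V') :
    S.modelSet V ⊆ S.modelSet V' := fun _ ⟨hx, hV⟩ => ⟨hx, h hV⟩

theorem sub_mem_modelSet (S : Scheme G H) {V : Set H} {x y : G} (hx : x ∈ S.modelSet V)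
    (hy : y ∈ S.modelSet V) : x - y ∈ S.modelSet (V - V) := by
  rw [mem_modelSet_iff] at *
  obtain ⟨a, ha, hla⟩ := hx
  obtain ⟨b, hb, hlb⟩ := hy
  exact ⟨a - b, Set.sub_mem_sub ha hb, S.lattice.sub_mem hla hlb⟩

/-- The canonical homomorphism from `G` to the torus `(G × H) ⧸ L`. -/
def toTorus (S : Scheme G H) : G →+ (G × H) ⧸ S.lattice :=
  (QuotientAddGroup.mk' S.lattice).comp (AddMonoidHom.inl G H)

theorem continuous_toTorus (S : Scheme G H) : Continuous S.toTorus :=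
  continuous_quotient_mk'.comp (by fun_prop : Continuous fun x : G => (x, (0 : H)))

variable [IsTopologicalAddGroup G] [T2Space G] [IsTopologicalAddGroup H] [T2Space H]

theorem finite_lattice_inter_prod (S : Scheme G H) {K : Set G} {K' : Set H} (hK : IsCompact K)
    (hK' : IsCompact K') : {l : S.lattice | (l : G × H) ∈ K ×ˢ K'}.Finite :=
  have := S.discrete
  finite_setOf_coe_mem_of_isCompact S.lattice (hK.prod hK')

theorem finite_inter_modelSet (S : Scheme G H) {K : Set G} {V : Set H} (hK : IsCompact K)
    (hV : IsCompact (closure V)) : (K ∩ S.modelSet V).Finite := by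
  refine ((S.finite_lattice_inter_prod hK hV).image fun l => l.1.1).subset ?_
  rintro x ⟨hx, hxV⟩
  obtain ⟨y, hy, hl⟩ := (S.mem_modelSet_iff V x).1 hxV
  exact ⟨⟨(x, y), hl⟩, ⟨hx, subset_closure hy⟩, rfl⟩

theorem finite_support_comb (S : Scheme G H) (f : C_c(G, ℂ)) (w : C_c(H, ℂ)) :
    (Function.support fun l : S.lattice => f l.1.1 * w l.1.2).Finite := by
  refine (S.finite_lattice_inter_prod f.hasCompactSupport w.hasCompactSupport).subset fun l hl => ?_
  exact ⟨subset_tsupport _ (left_ne_zero_of_mul hl), subset_tsupport _ (right_ne_zero_of_mul hl)⟩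

/-- The weighted Dirac comb `∑ w(x*) δ_x` over the projected lattice. -/
def comb (S : Scheme G H) (w : C_c(H, ℂ)) : RadonMeasure G where
  toLinearMap :=
    { toFun := fun f => ∑ᶠ l : S.lattice, f l.1.1 * w l.1.2
      map_add' := fun f g => by
        rw [← finsum_add_distrib (S.finite_support_comb f w) (S.finite_support_comb g w)]
        exact finsum_congr fun l => add_mul _ _ _
      map_smul' := fun c f => by
        rw [RingHom.id_apply, smul_finsum]
        exact finsum_congr fun l => mul_assoc _ _ _ }
  bound := by
    intro K hK
    obtain ⟨D, hD⟩ := w.hasCompactSupport.exists_bound_of_continuous w.continuous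
    let T := (S.finite_lattice_inter_prod hK w.hasCompactSupport).toFinset
    refine ⟨T.card * D, fun f hf M hM => ?_⟩
    change ‖∑ᶠ l : S.lattice, f l.1.1 * w l.1.2‖ ≤ _
    rw [finsum_eq_sum_of_support_subset (s := T)]
    · refine (norm_sum_le_of_le (f := fun l : S.lattice => f l.1.1 * w l.1.2) T
        (n := fun _ => M * D) fun l _ => ?_).trans (le_of_eq ?_)
      · rw [norm_mul]
        exact mul_le_mul (hM _) (hD _) (norm_nonneg _) ((norm_nonneg _).trans (hM 0))
      · rw [Finset.sum_const, nsmul_eq_mul]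
        ring
    · intro l hl
      simp only [T, Set.Finite.coe_toFinset]
      exact ⟨hf (subset_tsupport _ (left_ne_zero_of_mul hl)),
        subset_tsupport _ (right_ne_zero_of_mul hl)⟩

theorem comb_apply (S : Scheme G H) (w : C_c(H, ℂ)) (f : C_c(G, ℂ)) :
    S.comb w f = ∑ᶠ l : S.lattice, f l.1.1 * w l.1.2 := rfl

variable [LocallyCompactSpace G]

/-- The lattice has finitely many points in a compact box `N × closure V`, so `Λ(V)` is locally
finite. -/
theorem diff_singleton_modelSet_compl_mem_nhds (S : Scheme G H) {V : Set H}
    (hV : IsCompact (closure V)) (x : G) : (S.modelSet V \ {x})ᶜ ∈ 𝓝 x := by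
  obtain ⟨N, hN, hx⟩ := exists_compact_mem_nhds x
  have hfin : ((N ∩ S.modelSet V) \ {x}).Finite := (S.finite_inter_modelSet hN hV).sdiff
  filter_upwards [hx, hfin.isClosed.isOpen_compl.mem_nhds (by simp)] with y hyN hy hy'
  exact hy ⟨⟨hyN, hy'.1⟩, hy'.2⟩

theorem isClosed_modelSet (S : Scheme G H) {V : Set H} (hV : IsCompact (closure V)) :
    IsClosed (S.modelSet V) := by
  refine isOpen_compl_iff.1 (isOpen_iff_mem_nhds.2 fun x hx => ?_)
  have := S.diff_singleton_modelSet_compl_mem_nhds hV x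
  rwa [Set.sdiff_singleton_eq_self hx] at this

theorem exists_nhds_zero_separating_modelSet (S : Scheme G H) {V : Set H}
    (hV : IsCompact (closure V)) :
    ∃ O ∈ 𝓝 (0 : G), ∀ x ∈ S.modelSet V, ∀ y ∈ S.modelSet V, x - y ∈ O → x = y := by
  have hVV : IsCompact (closure (V - V)) := by
    rw [sub_eq_add_neg]
    exact (hV.add hV.neg).closure_of_subset
      (Set.add_subset_add subset_closure (Set.neg_subset_neg.2 subset_closure))
  refine ⟨_, S.diff_singleton_modelSet_compl_mem_nhds hVV 0, fun x hx y hy h => ?_⟩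
  by_contra hne
  exact h ⟨S.sub_mem_modelSet hx hy, sub_ne_zero.2 hne⟩

theorem supp_comb_subset (S : Scheme G H) (w : C_c(H, ℂ)) :
    (S.comb w).supp ⊆ S.modelSet (tsupport w) := by
  intro x hx
  by_contra hxn
  have hcl : IsClosed (S.modelSet (tsupport w)) :=
    S.isClosed_modelSet w.hasCompactSupport.isCompact.closure
  obtain ⟨f, hf, hne⟩ := hx _ (hcl.isOpen_compl.mem_nhds hxn)
  refine hne ((S.comb_apply w f).trans (finsum_eq_zero_of_forall_eq_zero fun l => ?_))
  by_contra h
  refine hf (subset_tsupport _ (left_ne_zero_of_mul h)) ((S.mem_modelSet_iff _ _).2 ?_)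
  exact ⟨l.1.2, subset_tsupport _ (right_ne_zero_of_mul h), l.2⟩

/-- The function `(s, t) ↦ f s * w (-t)`. -/
def tensorReflect (f : C_c(G, ℂ)) (w : C_c(H, ℂ)) : C_c(G × H, ℂ) where
  toFun p := f p.1 * w (-p.2)
  continuous_toFun := by fun_prop
  hasCompactSupport' := by
    refine HasCompactSupport.intro (f.hasCompactSupport.isCompact.prod
      w.hasCompactSupport.isCompact.neg) fun p hp => ?_
    by_contra h
    exact hp ⟨subset_tsupport _ (left_ne_zero_of_mul h),
      Set.mem_neg.2 (subset_tsupport _ (right_ne_zero_of_mul h))⟩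

variable [LocallyCompactSpace H]

theorem conv_comb_eq (S : Scheme G H) (w : C_c(H, ℂ)) (f : C_c(G, ℂ)) :
    ∃ F : C((G × H) ⧸ S.lattice, ℂ), (S.comb w).conv f = F ∘ S.toTorus := by
  have := S.discrete
  refine ⟨periodization S.lattice (tensorReflect f w), funext fun x => ?_⟩
  refine ((S.comb_apply w _).trans (finsum_congr fun l => ?_)).trans
    (periodization_mk S.lattice (tensorReflect f w) (x, 0)).symm
  change f (x - l.1.1) * w l.1.2 = f (x - l.1.1) * w (-(0 - l.1.2))
  rw [zero_sub, neg_neg]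

theorem comb_isStronglyAlmostPeriodic (S : Scheme G H) (w : C_c(H, ℂ)) :
    (S.comb w).IsStronglyAlmostPeriodic := by
  have := S.cocompact
  refine ⟨fun f => ?_, fun f => ?_⟩ <;> obtain ⟨F, hF⟩ := S.conv_comb_eq w f <;> rw [hF]
  · refine ⟨isUniformlyContinuous_comp_addMonoidHom F _ S.continuous_toTorus, ‖F‖, fun x => ?_⟩
    exact F.norm_coe_le_norm _
  · exact isBohrAlmostPeriodic_comp_addMonoidHom F _ S.continuous_toTorus

end Scheme

/-! ### Bump functions -/

/-- Complex-valued Urysohn bump function with values in `[0, 1]`. -/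
theorem exists_bump {X : Type*} [TopologicalSpace X] [T2Space X] [LocallyCompactSpace X]
    {K O : Set X} (hK : IsCompact K) (hO : IsOpen O) (hKO : K ⊆ O) :
    ∃ φ : C_c(X, ℝ), (∀ x ∈ K, φ x = 1) ∧ (∀ x, 0 ≤ φ x) ∧ tsupport φ ⊆ O := by
  obtain ⟨K', hK', hKK', hK'O⟩ := exists_compact_between hK hO hKO
  obtain ⟨f, hf1, hf0, hfc, hf⟩ := exists_continuous_one_zero_of_isCompact hK
    isOpen_interior.isClosed_compl (Set.disjoint_compl_right_iff_subset.2 hKK')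
  refine ⟨⟨f, hfc⟩, hf1, fun x => (hf x).1, ?_⟩
  refine (closure_minimal (fun x hx => ?_) hK'.isClosed).trans hK'O
  by_contra hx'
  exact hx (hf0 fun h => hx' (interior_subset h))

/-- The complex-valued function `x ↦ D * φ x`. -/
def scaleToComplex {X : Type*} [TopologicalSpace X] (D : ℝ) (φ : C_c(X, ℝ)) : C_c(X, ℂ) where
  toFun x := ((D * φ x : ℝ) : ℂ)
  continuous_toFun := by fun_prop
  hasCompactSupport' := φ.hasCompactSupport.comp_left (g := fun t : ℝ => ((D * t : ℝ) : ℂ)) (by simp)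

theorem tsupport_scaleToComplex_subset {X : Type*} [TopologicalSpace X] (D : ℝ) (φ : C_c(X, ℝ)) :
    tsupport (scaleToComplex D φ) ⊆ tsupport φ :=
  closure_mono fun x hx h => hx (by simp [scaleToComplex, h])

end

end CutProject

/-! ### The dominating comb -/

open CutProject in
theorem mainTheorem4 {G H : Type*}
    [AddCommGroup G] [TopologicalSpace G] [IsTopologicalAddGroup G] [T2Space G]
    [LocallyCompactSpace G] [SigmaCompactSpace G]
    [AddCommGroup H] [TopologicalSpace H] [IsTopologicalAddGroup H] [T2Space H]
    [LocallyCompactSpace H]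
    (S : CutProject.Scheme G H) (W U : Set H)
    (hW : IsCompact (closure W)) (hU : IsOpen U) (hWU : closure W ⊆ U) :
    CutProject.IsStrongDominatingSet (S.modelSet W) (S.modelSet U) := by
  refine ⟨S.isClosed_modelSet hW, S.modelSet_mono (subset_closure.trans hWU),
    fun μ hreal hbdd hsupp => ?_⟩
  obtain ⟨φ, hφ1, hφ0, hφU⟩ := exists_bump hW hU hWU
  obtain ⟨O, hO, hsep⟩ := S.exists_nhds_zero_separating_modelSet hW
  obtain ⟨b, hb1, -, hbO⟩ := exists_bump (isCompact_singleton (x := (0 : G)))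
    isOpen_interior (Set.singleton_subset_iff.2 (mem_interior_iff_mem_nhds.2 hO))
  let β : C_c(G, ℂ) := scaleToComplex 1 b
  obtain ⟨-, D, hD⟩ := hbdd β
  have hD0 : 0 ≤ D := (norm_nonneg _).trans (hD 0)
  have hβ0 : β 0 = 1 := by simp [β, scaleToComplex, hb1 0 rfl]
  have hβ {x y : G} (hx : x ∈ S.modelSet W) (hy : y ∈ S.modelSet W) (hne : x ≠ y) :
      β (x - y) = 0 := by
    by_contra h
    refine hne (hsep x hx y hy (interior_subset (hbO ?_)))
    exact tsupport_scaleToComplex_subset 1 b (subset_tsupport _ h)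
  let w := scaleToComplex D φ
  refine ⟨S.comb w, S.comb_isStronglyAlmostPeriodic w,
    (S.supp_comb_subset w).trans
      (S.modelSet_mono ((tsupport_scaleToComplex_subset D φ).trans hφU)), fun f hf => ?_⟩
  let T := (S.finite_lattice_inter_prod f.hasCompactSupport φ.hasCompactSupport).toFinset
  have hν : S.comb w f = ∑ l ∈ T, f l.1.1 * w l.1.2 := by
    rw [Scheme.comb_apply, finsum_eq_sum_of_support_subset (s := T)]
    intro l hl
    simp only [T, Set.Finite.coe_toFinset]
    exact ⟨subset_tsupport _ (left_ne_zero_of_mul hl),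
      tsupport_scaleToComplex_subset D φ (subset_tsupport _ (right_ne_zero_of_mul hl))⟩
  classical
  let T' := T.filter fun l => l.1.2 ∈ W
  have hμ : μ f = ∑ l ∈ T', f l.1.1 * μ.conv β l.1.1 := by
    -- On `Λ(W)`, `y ↦ β (x - y)` is the indicator of `x`, so the sum interpolates `f` on the
    -- support of `μ`.
    have h0 : μ (f - ∑ l ∈ T', f l.1.1 • RadonMeasure.reflect β l.1.1) = 0 := by
      refine μ.apply_eq_zero_of_eqOn_supp _ fun x hx => ?_
      obtain ⟨y, hy, hl⟩ := (S.mem_modelSet_iff _ _).1 (hsupp hx)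
      rw [CompactlySupportedContinuousMap.sub_apply, CompactlySupportedContinuousMap.sum_apply,
        sub_eq_zero, Finset.sum_eq_single (⟨(x, y), hl⟩ : S.lattice)]
      · change f x = f x * β (x - x)
        rw [sub_self, hβ0, mul_one]
      · intro l hlT hne
        have hlW : l.1.1 ∈ S.modelSet W :=
          (S.mem_modelSet_iff _ _).2 ⟨_, (Finset.mem_filter.1 hlT).2, l.2⟩
        change f l.1.1 * β (l.1.1 - x) = 0
        rw [hβ hlW (hsupp hx), mul_zero]
        exact fun h => hne (Subtype.ext (S.injOn_fst l.2 hl h))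
      · intro hnT
        change f x * β (x - x) = 0
        have : x ∉ tsupport f := fun hxf => hnT (Finset.mem_filter.2 ⟨by
          simp only [T, Set.Finite.mem_toFinset]
          refine ⟨hxf, subset_tsupport _ ?_⟩
          simp [hφ1 y (subset_closure hy)], hy⟩)
        rw [image_eq_zero_of_notMem_tsupport this, zero_mul]
    refine (sub_eq_zero.1 ((map_sub μ.toLinearMap _ _).symm.trans h0)).trans ?_
    refine (map_sum μ.toLinearMap _ _).trans (Finset.sum_congr rfl fun l _ => ?_)
    exact map_smul μ.toLinearMap _ _
  have hfr (x : G) : f x = ((f x).re : ℂ) := Complex.ext rfl (hf x).1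
  have hμr (x : G) : μ.conv β x = ((μ.conv β x).re : ℂ) :=
    Complex.ext rfl (hreal _ fun y => Complex.ofReal_im _)
  have hν' : S.comb w f = ((∑ l ∈ T, (f l.1.1).re * (D * φ l.1.2) : ℝ) : ℂ) := by
    rw [hν, Complex.ofReal_sum]
    refine Finset.sum_congr rfl fun l _ => ?_
    rw [hfr, Complex.ofReal_mul, Complex.ofReal_re]
    rfl
  have hμ' : μ f = ((∑ l ∈ T', (f l.1.1).re * (μ.conv β l.1.1).re : ℝ) : ℂ) := by
    rw [hμ, Complex.ofReal_sum]
    refine Finset.sum_congr rfl fun l _ => ?_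
    rw [Complex.ofReal_mul, ← hfr, ← hμr]
  rw [hν', hμ', ← Complex.ofReal_sub, Complex.ofReal_im, Complex.ofReal_re, sub_nonneg]
  -- Over `W` the weight is exactly `D`; the remaining terms of `ν` are nonnegative.
  refine ⟨rfl, (Finset.sum_le_sum fun l hl => ?_).trans
    (Finset.sum_le_sum_of_subset_of_nonneg (Finset.filter_subset _ _) fun l _ _ =>
      mul_nonneg (hf _).2 (mul_nonneg hD0 (hφ0 _)))⟩
  rw [hφ1 _ (subset_closure (Finset.mem_filter.1 hl).2), mul_one]
  exact mul_le_mul_of_nonneg_left ((Complex.re_le_norm _).trans (hD _)) (hf _).2
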